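/- Let $d\ge 1$, let $\mathbb T^d=\mathbb R^d/\mathbb Z^d$ with its normalised Lebesgue measure, and let $e_k(x)=e^{2\pi i k\cdot x}$, $k\in\mathbb Z^d$, be the Fourier basis of the complex space $L^2(\mathbb T^d)$. For $\sigma\in\mathbb R$ and $q\in(1,\infty)$ let $H^{\sigma,q}(\mathbb T^d)$ be the Bessel potential space of all periodic distributions $u$ with $\|u\|_{H^{\sigma,q}(\mathbb T^d)}:=\|(1-\Delta)^{\sigma/2}u\|_{L^q(\mathbb T^d)}<\infty$, where $(1-\Delta)^{\sigma/2}$ is the Fourier multiplier with symbol $(1+4\pi^2|k|^2)^{\sigma/2}$. Let $(\gamma_n)_{n\ge1}$ be independent standard Gaussian random variables on a probability space $(\Omega,\mathcal A,\mathbb P)$, and let $(h_n)_{n\ge1}$ be an orthonormal basis of $L^2(\mathbb T^d)$. For a Banach space $X$, a bounded operator $T:L^2(\mathbb T^d)\to X$ is called $\gamma$-radonifying if $\sum_{n\ge1}\gamma_nTh_n$ converges in $L^2(\Omega;X)$, and then $$\|T\|_{\gamma(L^2(\mathbb T^d),X)}:=\Big(\mathbb E\Big\|\sum_{n\ge1}\gamma_nTh_n\Big\|_X^2\Big)^{1/2};$$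 otherwise $\|T\|_{\gamma(L^2(\mathbb T^d),X)}:=\infty$. **Proposition.** Let $q\in(1,\infty)$, $\eta\in(1,\infty)$, $\zeta\in[2,\infty]$ and $s\in(0,d)$. For a finitely nonzero real sequence $\mu=(\mu_k)_{k\in\mathbb Z^d}$ let $R_\mu$ be the bounded operator on $L^2(\mathbb T^d)$ with $R_\mu e_k=\mu_ke_k$ for all $k\in\mathbb Z^d$, and for a real-valued $g\in C^\infty(\mathbb T^d)$ let $M_g$ be the operator of multiplication by $g$. Suppose that there is a constant $C>0$ such that for all real-valued $g\in C^\infty(\mathbb T^d)$ and all finitely nonzero real sequences $\mu$ the operator $M_gR_\mu:L^2(\mathbb T^d)\to H^{-s,q}(\mathbb T^d)$ satisfies $$\|M_gR_\mu\|_{\gamma(L^2(\mathbb T^d),H^{-s,q}(\mathbb T^d))}\le C\,\|\mu\|_{\ell^\zeta(\mathbb Z^d)}\,\|g\|_{L^\eta(\mathbb T^d)}.$$ Then $$\frac sd+\frac1q\ \ge\ \frac1\eta+\frac12-\frac1\zeta ,$$ where $1/\zeta=0$ if $\zeta=\infty$. -/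

import Mathlib

open MeasureTheory ProbabilityTheory Filter Topology UnitAddTorus
open scoped ENNReal

noncomputable section

namespace PeriodicSobolev

/-! ### The torus -/

/-- The Lebesgue (= normalised Haar) measure on `𝕋ᵈ = ℝᵈ / ℤᵈ`. -/
abbrev torusMeasure (d : ℕ) : Measure (UnitAddTorus (Fin d)) :=
  Measure.pi fun _ => AddCircle.haarAddCircle

/-- The complex Lebesgue space `Lᵖ(𝕋ᵈ)`. -/
abbrev LpTorus (d : ℕ) (p : ℝ≥0∞) : Type := Lp ℂ p (torusMeasure d)

/-- A real function on the torus is smooth if its `ℤᵈ`-periodic lift to `ℝᵈ` is `C^∞`. -/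
def IsSmooth {d : ℕ} (g : UnitAddTorus (Fin d) → ℝ) : Prop :=
  ContDiff ℝ (⊤ : ℕ∞) fun x : Fin d → ℝ => g fun i => (x i : UnitAddCircle)

lemma mFourierCoeff_eq_integral_torusMeasure {d : ℕ} (f : UnitAddTorus (Fin d) → ℂ)
    (k : Fin d → ℤ) :
    mFourierCoeff f k = ∫ t, mFourier (-k) t * f t ∂(torusMeasure d) := rfl

lemma integrable_LpTorus {d : ℕ} {q : ℝ≥0∞} [Fact (1 ≤ q)] (F : LpTorus d q) :
    Integrable F (torusMeasure d) :=
  (Lp.memLp F).integrable Fact.out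

lemma integrable_mFourier_mul {d : ℕ} {F : UnitAddTorus (Fin d) → ℂ}
    (hF : Integrable F (torusMeasure d)) (φ : C(UnitAddTorus (Fin d), ℂ)) :
    Integrable (fun t => φ t * F t) (torusMeasure d) :=
  hF.bdd_mul φ.continuous.aestronglyMeasurable (c := ‖φ‖)
    (Eventually.of_forall fun t => φ.norm_coe_le_norm t)

lemma norm_mFourierCoeff_le {d : ℕ} (F : UnitAddTorus (Fin d) → ℂ) (k : Fin d → ℤ) :
    ‖mFourierCoeff F k‖ ≤ ∫ t, ‖F t‖ ∂(torusMeasure d) := by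
  rw [mFourierCoeff_eq_integral_torusMeasure]
  refine (norm_integral_le_integral_norm _).trans (le_of_eq ?_)
  refine integral_congr_ae (Eventually.of_forall fun t => ?_)
  have h1 : ‖mFourier (-k) t‖ = 1 := by
    change ‖∏ i, fourier ((-k) i) (t i)‖ = 1
    rw [norm_prod]
    exact Finset.prod_eq_one fun i _ => Circle.norm_coe _
  change ‖mFourier (-k) t * F t‖ = ‖F t‖
  rw [norm_mul, h1, one_mul]

/-- An integrable function is determined by its Fourier coefficients. -/
lemma ae_eq_zero_of_mFourierCoeff_eq_zero {d : ℕ} {F : UnitAddTorus (Fin d) → ℂ}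
    (hF : Integrable F (torusMeasure d)) (h0 : ∀ k, mFourierCoeff F k = 0) :
    F =ᵐ[torusMeasure d] 0 := by
  let L : C(UnitAddTorus (Fin d), ℂ) →ₗ[ℂ] ℂ :=
    { toFun := fun φ => ∫ t, φ t * F t ∂(torusMeasure d)
      map_add' := fun φ ψ => by
        simp only [ContinuousMap.add_apply, add_mul]
        exact integral_add (integrable_mFourier_mul hF φ) (integrable_mFourier_mul hF ψ)
      map_smul' := fun c φ => by
        simp only [ContinuousMap.smul_apply, smul_eq_mul, mul_assoc, RingHom.id_apply]
        exact integral_const_mul c _ }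
  let L' : C(UnitAddTorus (Fin d), ℂ) →L[ℂ] ℂ :=
    L.mkContinuous (∫ t, ‖F t‖ ∂(torusMeasure d)) fun φ => by
      refine (norm_integral_le_integral_norm _).trans ?_
      rw [← integral_mul_const]
      refine integral_mono (integrable_mFourier_mul hF φ).norm (hF.norm.mul_const _) fun t => ?_
      simp only [norm_mul]
      rw [mul_comm]
      gcongr
      exact φ.norm_coe_le_norm t
  have hL : ∀ φ, L' φ = 0 := by
    intro φ
    have hle : Submodule.span ℂ (Set.range (mFourier (d := Fin d))) ≤ L'.ker := by
      rw [Submodule.span_le]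
      rintro _ ⟨k, rfl⟩
      have := h0 (-k)
      rw [mFourierCoeff_eq_integral_torusMeasure, neg_neg] at this
      exact this
    have hcl := Submodule.topologicalClosure_minimal _ hle L'.isClosed_ker
    rw [span_mFourier_closure_eq_top] at hcl
    exact hcl (Submodule.mem_top (x := φ))
  refine ae_eq_zero_of_forall_setIntegral_isClosed_eq_zero hF fun s hs => ?_
  have hδ : ∀ n : ℕ, (0 : ℝ) < 1 / ((n : ℝ) + 1) := fun n => Nat.one_div_pos_of_nat
  have hlim := thickenedIndicator_tendsto_indicator_closure hδ
    tendsto_one_div_add_atTop_nhds_zero_nat s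
  rw [tendsto_pi_nhds] at hlim
  have key : Tendsto (fun n : ℕ => ∫ t, ((thickenedIndicator (hδ n) s t : ℝ) : ℂ) * F t
      ∂(torusMeasure d)) atTop (𝓝 (∫ t, s.indicator F t ∂(torusMeasure d))) := by
    refine tendsto_integral_of_dominated_convergence (fun t => ‖F t‖) (fun n => ?_) hF.norm
      (fun n => Eventually.of_forall fun t => ?_) (Eventually.of_forall fun t => ?_)
    · refine AEStronglyMeasurable.mul ?_ hF.aestronglyMeasurable
      refine Continuous.aestronglyMeasurable ?_
      have := (thickenedIndicator (hδ n) s).continuous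
      fun_prop
    · rw [norm_mul]
      have h1 : (thickenedIndicator (hδ n) s t : ℝ) ≤ 1 := by
        exact_mod_cast thickenedIndicator_le_one (hδ n) s t
      have h2 : ‖((thickenedIndicator (hδ n) s t : ℝ) : ℂ)‖ ≤ 1 := by
        rw [Complex.norm_real, Real.norm_of_nonneg (NNReal.coe_nonneg _)]; exact h1
      exact mul_le_of_le_one_left (norm_nonneg _) h2
    · have h3 := hlim t
      rw [hs.closure_eq] at h3
      have h4 : Tendsto (fun n : ℕ => ((thickenedIndicator (hδ n) s t : ℝ) : ℂ)) atTop
          (𝓝 (((s.indicator (fun _ => (1 : NNReal)) t : NNReal) : ℝ) : ℂ)) :=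
        ((Complex.continuous_ofReal.comp NNReal.continuous_coe).tendsto _).comp h3
      have h5 := h4.mul_const (F t)
      convert h5 using 2
      by_cases ht : t ∈ s <;> simp [ht]
  rw [integral_indicator hs.measurableSet] at key
  refine tendsto_nhds_unique key ?_
  have : ∀ n : ℕ, ∫ t, ((thickenedIndicator (hδ n) s t : ℝ) : ℂ) * F t ∂(torusMeasure d) = 0 := by
    intro n
    exact hL ⟨fun t => ((thickenedIndicator (hδ n) s t : ℝ) : ℂ), by
      have := (thickenedIndicator (hδ n) s).continuous
      fun_prop⟩
  simp only [this]
  exact tendsto_const_nhds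

/-! ### Periodic distributions and Bessel potential spaces -/

/-- The symbol `1 + 4π²|k|²` of `1 - Δ` on `𝕋ᵈ`. -/
def symbol {d : ℕ} (k : Fin d → ℤ) : ℝ := 1 + 4 * Real.pi ^ 2 * ∑ i, (k i : ℝ) ^ 2

lemma one_le_symbol {d : ℕ} (k : Fin d → ℤ) : 1 ≤ symbol k := by
  unfold symbol
  have : 0 ≤ 4 * Real.pi ^ 2 * ∑ i, (k i : ℝ) ^ 2 := by positivity
  linarith

lemma symbol_pos {d : ℕ} (k : Fin d → ℤ) : 0 < symbol k := one_pos.trans_le (one_le_symbol k)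

/-- Families of Fourier coefficients of at most polynomial growth. -/
def slowlyGrowing (d : ℕ) : Submodule ℂ ((Fin d → ℤ) → ℂ) where
  carrier := {a | ∃ C N : ℝ, ∀ k, ‖a k‖ ≤ C * symbol k ^ N}
  zero_mem' := ⟨0, 0, fun k => by simp⟩
  add_mem' := by
    rintro a b ⟨C, N, hC⟩ ⟨D, M, hD⟩
    refine ⟨|C| + |D|, max N M, fun k => ?_⟩
    have h1 : ‖a k‖ ≤ |C| * symbol k ^ max N M := (hC k).trans <|
      mul_le_mul (le_abs_self C) (Real.rpow_le_rpow_of_exponent_le (one_le_symbol k)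
        (le_max_left _ _)) (Real.rpow_nonneg (symbol_pos k).le _) (abs_nonneg _)
    have h2 : ‖b k‖ ≤ |D| * symbol k ^ max N M := (hD k).trans <|
      mul_le_mul (le_abs_self D) (Real.rpow_le_rpow_of_exponent_le (one_le_symbol k)
        (le_max_right _ _)) (Real.rpow_nonneg (symbol_pos k).le _) (abs_nonneg _)
    rw [add_mul]
    exact (norm_add_le _ _).trans (add_le_add h1 h2)
  smul_mem' := by
    rintro c a ⟨C, N, hC⟩
    refine ⟨‖c‖ * C, N, fun k => ?_⟩
    rw [Pi.smul_apply, norm_smul, mul_assoc]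
    exact mul_le_mul_of_nonneg_left (hC k) (norm_nonneg c)

/-- The space `𝒟'(𝕋ᵈ)` of periodic distributions `u = ∑ₖ û(k) eₖ`, realised through the
Fourier isomorphism with the families `(û(k))` of at most polynomial growth. -/
def PeriodicDistribution (d : ℕ) : Type := slowlyGrowing d

instance (d : ℕ) : AddCommGroup (PeriodicDistribution d) :=
  inferInstanceAs (AddCommGroup (slowlyGrowing d))

instance (d : ℕ) : Module ℂ (PeriodicDistribution d) :=
  inferInstanceAs (Module ℂ (slowlyGrowing d))

/-- The `k`-th Fourier coefficient of a periodic distribution. -/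
def PeriodicDistribution.coeff {d : ℕ} (u : PeriodicDistribution d) (k : Fin d → ℤ) : ℂ := u.1 k

lemma PeriodicDistribution.ext {d : ℕ} {u v : PeriodicDistribution d}
    (h : ∀ k, u.coeff k = v.coeff k) : u = v := Subtype.ext (funext h)

/-- The distribution `(1 - Δ)^{σ/2} u`. -/
def besselPotential {d : ℕ} (σ : ℝ) : PeriodicDistribution d →ₗ[ℂ] PeriodicDistribution d where
  toFun u := ⟨fun k => ((symbol k ^ (σ / 2) : ℝ) : ℂ) * u.coeff k, by
    obtain ⟨C, N, hC⟩ := u.2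
    refine ⟨C, σ / 2 + N, fun k => ?_⟩
    have hpos := Real.rpow_pos_of_pos (symbol_pos k) (σ / 2)
    rw [norm_mul, Complex.norm_real, Real.norm_of_nonneg hpos.le,
      Real.rpow_add (symbol_pos k), mul_left_comm]
    exact mul_le_mul_of_nonneg_left (hC k) hpos.le⟩
  map_add' u v := Subtype.ext <| funext fun k => mul_add _ _ _
  map_smul' c u := Subtype.ext <| funext fun k => mul_left_comm _ _ _

lemma besselPotential_injective {d : ℕ} (σ : ℝ) :
    Function.Injective (besselPotential (d := d) σ) := by
  intro u v h
  refine PeriodicDistribution.ext fun k => ?_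
  have h1 : ((symbol k ^ (σ / 2) : ℝ) : ℂ) * u.coeff k
      = ((symbol k ^ (σ / 2) : ℝ) : ℂ) * v.coeff k :=
    congrArg (fun w : PeriodicDistribution d => w.coeff k) h
  have h2 : ((symbol k ^ (σ / 2) : ℝ) : ℂ) ≠ 0 :=
    Complex.ofReal_ne_zero.2 (Real.rpow_pos_of_pos (symbol_pos k) _).ne'
  exact mul_left_cancel₀ h2 h1

/-- The embedding `L^q(𝕋ᵈ) ↪ 𝒟'(𝕋ᵈ)`. -/
def LpTorus.toDistribution {d : ℕ} (q : ℝ≥0∞) [Fact (1 ≤ q)] :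
    LpTorus d q →ₗ[ℂ] PeriodicDistribution d where
  toFun F := ⟨fun k => mFourierCoeff F k, ∫ t, ‖F t‖ ∂(torusMeasure d), 0, fun k => by
    simpa using norm_mFourierCoeff_le F k⟩
  map_add' F G := Subtype.ext <| funext fun k => by
    change mFourierCoeff _ k = mFourierCoeff F k + mFourierCoeff G k
    simp only [mFourierCoeff_eq_integral_torusMeasure]
    rw [← integral_add (integrable_mFourier_mul (integrable_LpTorus F) _)
      (integrable_mFourier_mul (integrable_LpTorus G) _)]
    refine integral_congr_ae ?_
    filter_upwards [Lp.coeFn_add F G] with t ht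
    have ht' : (F + G : LpTorus d q) t = F t + G t := ht
    rw [← mul_add, ← ht']
  map_smul' c F := Subtype.ext <| funext fun k => by
    change mFourierCoeff _ k = c * mFourierCoeff F k
    simp only [mFourierCoeff_eq_integral_torusMeasure]
    rw [← integral_const_mul]
    refine integral_congr_ae ?_
    filter_upwards [Lp.coeFn_smul c F] with t ht
    have ht' : (c • F : LpTorus d q) t = c * F t := ht
    rw [mul_left_comm, ← ht']

lemma LpTorus.toDistribution_injective {d : ℕ} (q : ℝ≥0∞) [Fact (1 ≤ q)] :
    Function.Injective (LpTorus.toDistribution (d := d) q) := by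
  rw [injective_iff_map_eq_zero]
  intro F hF
  rw [Lp.eq_zero_iff_ae_eq_zero]
  refine ae_eq_zero_of_mFourierCoeff_eq_zero (integrable_LpTorus F) fun k => ?_
  exact congrArg (fun w : PeriodicDistribution d => w.coeff k) hF

/-- The Bessel potential space `H^{σ,q}(𝕋ᵈ)`: all periodic distributions `u` for which
`(1 - Δ)^{σ/2} u` belongs to `L^q(𝕋ᵈ)`. -/
def BesselSpace (d : ℕ) (σ : ℝ) (q : ℝ≥0∞) [Fact (1 ≤ q)] :
    Submodule ℂ (PeriodicDistribution d) :=
  (LinearMap.range (LpTorus.toDistribution (d := d) q)).comap (besselPotential σ)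

/-- `u ↦ (1 - Δ)^{σ/2} u`, as a map from `H^{σ,q}(𝕋ᵈ)` to `L^q(𝕋ᵈ)`. -/
def BesselSpace.toLp {d : ℕ} {σ : ℝ} {q : ℝ≥0∞} [Fact (1 ≤ q)] :
    BesselSpace d σ q →ₗ[ℂ] LpTorus d q :=
  (LinearEquiv.ofInjective _ (LpTorus.toDistribution_injective q)).symm.toLinearMap ∘ₗ
    (besselPotential σ).restrict (fun _ hu => hu)

lemma BesselSpace.toDistribution_toLp {d : ℕ} {σ : ℝ} {q : ℝ≥0∞} [Fact (1 ≤ q)]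
    (u : BesselSpace d σ q) :
    LpTorus.toDistribution q (BesselSpace.toLp u) = besselPotential σ u.1 :=
  congrArg Subtype.val
    ((LinearEquiv.ofInjective _ (LpTorus.toDistribution_injective (d := d) q)).apply_symm_apply
      ⟨besselPotential σ u.1, u.2⟩)

lemma BesselSpace.toLp_injective {d : ℕ} {σ : ℝ} {q : ℝ≥0∞} [Fact (1 ≤ q)] :
    Function.Injective (BesselSpace.toLp (d := d) (σ := σ) (q := q)) := by
  intro u v h
  apply Subtype.ext
  apply besselPotential_injective σ
  rw [← toDistribution_toLp, ← toDistribution_toLp, h]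

/-- The norm of `H^{σ,q}(𝕋ᵈ)` is `‖u‖ = ‖(1 - Δ)^{σ/2} u‖_{L^q(𝕋ᵈ)}`. -/
instance {d : ℕ} {σ : ℝ} {q : ℝ≥0∞} [Fact (1 ≤ q)] : NormedAddCommGroup (BesselSpace d σ q) :=
  NormedAddCommGroup.induced _ _ BesselSpace.toLp BesselSpace.toLp_injective

instance {d : ℕ} {σ : ℝ} {q : ℝ≥0∞} [Fact (1 ≤ q)] : NormedSpace ℂ (BesselSpace d σ q) :=
  NormedSpace.induced ℂ _ _ BesselSpace.toLp

lemma BesselSpace.norm_def {d : ℕ} {σ : ℝ} {q : ℝ≥0∞} [Fact (1 ≤ q)] (u : BesselSpace d σ q) :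
    ‖u‖ = ‖BesselSpace.toLp u‖ := rfl

/-! ### `γ`-radonifying operators -/

/-- `(γₙ)` is a sequence of independent standard Gaussian random variables. -/
structure IsGaussianSequence {Ω : Type*} [MeasurableSpace Ω] (P : Measure Ω)
    (γ : ℕ → Ω → ℝ) : Prop where
  hasLaw : ∀ n, HasLaw (γ n) (gaussianReal 0 1) P
  indep : iIndepFun γ P

section GammaNorm

variable {Ω : Type*} [MeasurableSpace Ω] (P : Measure Ω) (γ : ℕ → Ω → ℝ)
  {H : Type*} [NormedAddCommGroup H] [InnerProductSpace ℂ H] (h : HilbertBasis ℕ ℂ H)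
  {X : Type*} [NormedAddCommGroup X] [NormedSpace ℂ X] (T : H →L[ℂ] X)

/-- `S` is the sum of the Gaussian series `∑ₙ γₙ T hₙ`, with convergence in `L²(Ω; X)`. -/
def IsGammaSum (S : Ω → X) : Prop :=
  MemLp S 2 P ∧
    Tendsto (fun N : ℕ => eLpNorm (fun ω => S ω - ∑ n ∈ Finset.range N, (γ n ω : ℂ) • T (h n)) 2 P)
      atTop (𝓝 0)

/-- `T` is `γ`-radonifying: the series `∑ₙ γₙ T hₙ` converges in `L²(Ω; X)`. -/
def IsGammaRadonifying : Prop := ∃ S : Ω → X, IsGammaSum P γ h T S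

/-- The norm `‖T‖_{γ(H,X)} = (𝔼 ‖∑ₙ γₙ T hₙ‖²)^{1/2}`. The sum of the series is unique up to
null sets, so that the infimum is over a single value if `T` is `γ`-radonifying; it is `∞` if `T`
is not. -/
def gammaNorm : ℝ≥0∞ := ⨅ (S : Ω → X) (_ : IsGammaSum P γ h T S), eLpNorm S 2 P

end GammaNorm

/-! ### Diagonal operators and multiplication operators -/

/-- The operator `R_μ : L²(𝕋ᵈ) → L²(𝕋ᵈ)`, diagonal in the Fourier basis
`eₖ(x) = exp(2πi k·x)`, with `R_μ eₖ = μₖ eₖ`, for a finitely nonzero sequence `μ`. -/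
def diagonalOp {d : ℕ} (μ : (Fin d → ℤ) →₀ ℝ) : LpTorus d 2 →L[ℂ] LpTorus d 2 :=
  ∑ k ∈ μ.support, (μ k : ℂ) •
    InnerProductSpace.rankOne ℂ (mFourierLp 2 k : LpTorus d 2) (mFourierLp 2 k : LpTorus d 2)

lemma diagonalOp_mFourierLp {d : ℕ} (μ : (Fin d → ℤ) →₀ ℝ) (k : Fin d → ℤ) :
    diagonalOp μ (mFourierLp 2 k : LpTorus d 2) = (μ k : ℂ) • (mFourierLp 2 k : LpTorus d 2) := by
  have ho := orthonormal_iff_ite.1 (orthonormal_mFourier (d := Fin d))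
  simp only [diagonalOp, sum_apply, smul_apply,
    InnerProductSpace.rankOne_apply]
  have : ∀ j ∈ μ.support, (μ j : ℂ) • (inner ℂ (mFourierLp 2 j : LpTorus d 2)
      (mFourierLp 2 k : LpTorus d 2)) • (mFourierLp 2 j : LpTorus d 2)
      = if j = k then (μ k : ℂ) • (mFourierLp 2 k : LpTorus d 2) else 0 := by
    intro j _
    have h1 : inner ℂ (mFourierLp 2 j : LpTorus d 2) (mFourierLp 2 k : LpTorus d 2)
      = if j = k then 1 else 0 := ho j k
    rw [h1]
    by_cases hjk : j = k
    · subst hjk; simp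
    · simp [hjk]
  rw [Finset.sum_congr rfl this, Finset.sum_ite_eq']
  by_cases hk : k ∈ μ.support
  · simp [hk]
  · simp [Finsupp.notMem_support_iff.1 hk]

/-- The bounded operator `T : L²(𝕋ᵈ) → H^{σ,q}(𝕋ᵈ)` is `M_g R`: for every `f ∈ L²(𝕋ᵈ)`, the
distribution `T f` is the function `x ↦ g(x) (R f)(x)`. -/
def IsMulComp {d : ℕ} {σ : ℝ} {q : ℝ≥0∞} [Fact (1 ≤ q)] (g : UnitAddTorus (Fin d) → ℝ)
    (R : LpTorus d 2 →L[ℂ] LpTorus d 2) (T : LpTorus d 2 →L[ℂ] BesselSpace d σ q) : Prop :=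
  ∀ (f : LpTorus d 2) (k : Fin d → ℤ),
    (T f).1.coeff k = mFourierCoeff (fun x => (g x : ℂ) * R f x) k

end PeriodicSobolev

end

open PeriodicSobolev

/-! The hypothesis is tested at scale `1 / N` and powers of `N` are compared as `N → ∞`. Take `g =
|∑_{j ∈ {0,…,N-1}ᵈ} e_j|²`, which concentrates near the origin, and let `μ` be the indicator of the
same box. Then `‖μ‖_ζ ≤ N^{d/ζ}`, and interpolating between `‖g‖₁ = N^d` and `‖g‖_∞ ≤ N^{2d}` gives
`‖g‖_η ≤ N^{2d - d/η}` (`eLpNorm_fejer_le`).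

For the lower bound, the `γ`-norm controls the `L^q` norm of the square function `(∑_k
|(1-Δ)^{-s/2}(g e_k)|²)^{1/2}`, with `k` in the box. All frequencies involved are `O(N)`, so the
Bessel potential costs at most a factor of order `N^{-s}`. On a cube of side comparable to `1 / N`
the waves making up `g` are nearly in phase, so each summand has modulus at least `c N^{2d-s}` there
(`norm_besselFejer_ge`), and the square function is at least `c N^{d/2+2d-s}`. Hölder's inequality
on this cube, of measure comparable to `N^{-d}`, turns this into a bound for the `γ`-norm
(`IsGaussianSequence.le_gammaNorm`). Comparing exponents yields `d/2 - s ≤ d/ζ - d/η + d/q`.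

Only first moments are needed in the lower bound: integrating over the cube and over `Ω` allows
Tonelli's theorem to replace any Kahane–Khintchine inequality. -/

namespace PeriodicSobolev

/-! ### First moments of Gaussian sums -/

section Gaussian

variable {Ω : Type*} [MeasurableSpace Ω] {P : Measure Ω} {γ : ℕ → Ω → ℝ}

lemma IsGaussianSequence.hasLaw_sum [IsProbabilityMeasure P] (hγ : IsGaussianSequence P γ)
    (b : ℕ → ℝ) (M : ℕ) :
    HasLaw (fun ω => ∑ n ∈ Finset.range M, b n * γ n ω)
      (gaussianReal 0 (∑ n ∈ Finset.range M, b n ^ 2).toNNReal) P := by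
  induction M with
  | zero =>
    simp only [Finset.range_zero, Finset.sum_empty, Real.toNNReal_zero, gaussianReal_zero_var]
    exact hasLaw_dirac_iff.2 (Eventually.of_forall fun _ => rfl)
  | succ M ih =>
    have hm : ∀ n, AEMeasurable (fun ω => b n * γ n ω) P :=
      fun n => (hγ.hasLaw n).aemeasurable.const_mul _
    have hind : iIndepFun (fun n ω => b n * γ n ω) P :=
      hγ.indep.comp (fun n x => b n * x) fun n => measurable_const_mul _
    have h1 := hind.indepFun_finsetSum_of_notMem₀ hm (s := Finset.range M) (i := M) (by simp)
    have h2 := gaussianReal_const_mul (hγ.hasLaw M) (b M)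
    have hs : (∑ j ∈ Finset.range M, fun ω => b j * γ j ω)
        = fun ω => ∑ n ∈ Finset.range M, b n * γ n ω := by
      ext ω; simp
    rw [hs] at h1
    have h3 := gaussianReal_add_gaussianReal_of_indepFun h1 ih.map_eq h2.map_eq
    refine ⟨ih.aemeasurable.add h2.aemeasurable |>.congr ?_, ?_⟩
    · exact Eventually.of_forall fun ω => by simp [Finset.sum_range_succ]
    · convert h3 using 2
      · ext ω; simp [Finset.sum_range_succ]
      · simp
      · rw [Finset.sum_range_succ, Real.toNNReal_add (by positivity) (by positivity)]
        congr 1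
        ext
        simp [sq_nonneg]

lemma lintegral_enorm_gaussianReal (v : ℝ) (hv : 0 ≤ v) :
    ∫⁻ x, ‖x‖ₑ ∂(gaussianReal 0 v.toNNReal)
      = (∫⁻ x, ‖x‖ₑ ∂(gaussianReal 0 1)) * ENNReal.ofReal (√v) := by
  have h := gaussianReal_map_const_mul (μ := 0) (v := 1) (√v)
  have hv' : (NNReal.mk (√v ^ 2) (sq_nonneg _)) * 1 = v.toNNReal := by
    ext; simp [Real.sq_sqrt hv, hv]
  rw [hv', mul_zero] at h
  rw [← h, lintegral_map (by fun_prop) (by fun_prop)]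
  simp_rw [enorm_mul]
  rw [lintegral_const_mul _ (by fun_prop), mul_comm, Real.enorm_eq_ofReal (Real.sqrt_nonneg v)]

/-- The value of the first absolute moment is irrelevant: as a constant independent of `N` it only
has to be positive and finite. -/
lemma lintegral_enorm_gaussianReal_ne_zero : ∫⁻ x, ‖x‖ₑ ∂(gaussianReal 0 1) ≠ 0 := by
  rw [Ne, lintegral_eq_zero_iff (by fun_prop)]
  intro h
  have := nullSingletonClass_gaussianReal (μ := 0) (v := 1) one_ne_zero
  have h2 : ∀ᵐ x ∂(gaussianReal 0 1), x ≠ 0 := by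
    rw [ae_iff]; simp
  have h3 : ∀ᵐ x ∂(gaussianReal 0 1), False := by
    filter_upwards [h, h2] with x hx hx'
    exact hx' (by simpa using hx)
  exact IsProbabilityMeasure.ne_zero (gaussianReal 0 1) (by simpa using h3)

lemma lintegral_enorm_gaussianReal_ne_top : ∫⁻ x, ‖x‖ₑ ∂(gaussianReal 0 1) ≠ ∞ := by
  have h := (memLp_id_gaussianReal (μ := 0) (v := 1) 1).2
  rw [ENNReal.coe_one, eLpNorm_one_eq_lintegral_enorm] at h
  exact h.ne

lemma IsGaussianSequence.lintegral_enorm_sum [IsProbabilityMeasure P]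
    (hγ : IsGaussianSequence P γ) (b : ℕ → ℝ) (M : ℕ) :
    ∫⁻ ω, ‖∑ n ∈ Finset.range M, b n * γ n ω‖ₑ ∂P
      = (∫⁻ x, ‖x‖ₑ ∂(gaussianReal 0 1)) *
        ENNReal.ofReal (√(∑ n ∈ Finset.range M, b n ^ 2)) := by
  rw [← lintegral_enorm_gaussianReal _ (by positivity)]
  exact (hγ.hasLaw_sum b M).lintegral_comp (f := fun x => ‖x‖ₑ) (by fun_prop)

/-- The first absolute moment of a complex Gaussian sum dominates its standard deviation. -/
lemma IsGaussianSequence.sqrt_sum_le_lintegral_enorm_sum [IsProbabilityMeasure P]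
    (hγ : IsGaussianSequence P γ) (a : ℕ → ℂ) (M : ℕ) :
    (∫⁻ x, ‖x‖ₑ ∂(gaussianReal 0 1)) * ENNReal.ofReal (√(∑ n ∈ Finset.range M, ‖a n‖ ^ 2))
      ≤ 2 * ∫⁻ ω, ‖∑ n ∈ Finset.range M, (γ n ω : ℂ) * a n‖ₑ ∂P := by
  -- The real and imaginary parts are driven by the same `γ n` and hence are not independent. Each
  -- is a real Gaussian dominated by the modulus; adding the two bounds produces the factor `2`.
  have hre : ∫⁻ ω, ‖∑ n ∈ Finset.range M, (a n).re * γ n ω‖ₑ ∂P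
      ≤ ∫⁻ ω, ‖∑ n ∈ Finset.range M, (γ n ω : ℂ) * a n‖ₑ ∂P := by
    refine lintegral_mono fun ω => ?_
    rw [enorm_le_iff_norm_le, Real.norm_eq_abs]
    convert Complex.abs_re_le_norm _ using 2
    simp [mul_comm]
  have him : ∫⁻ ω, ‖∑ n ∈ Finset.range M, (a n).im * γ n ω‖ₑ ∂P
      ≤ ∫⁻ ω, ‖∑ n ∈ Finset.range M, (γ n ω : ℂ) * a n‖ₑ ∂P := by
    refine lintegral_mono fun ω => ?_
    rw [enorm_le_iff_norm_le, Real.norm_eq_abs]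
    convert Complex.abs_im_le_norm _ using 2
    simp [mul_comm]
  rw [hγ.lintegral_enorm_sum] at hre him
  rw [two_mul]
  refine le_trans ?_ (add_le_add hre him)
  rw [← mul_add, ← ENNReal.ofReal_add (Real.sqrt_nonneg _) (Real.sqrt_nonneg _)]
  gcongr
  have : ∑ n ∈ Finset.range M, ‖a n‖ ^ 2
      = ∑ n ∈ Finset.range M, (a n).re ^ 2 + ∑ n ∈ Finset.range M, (a n).im ^ 2 := by
    rw [← Finset.sum_add_distrib]
    refine Finset.sum_congr rfl fun n _ => ?_
    rw [Complex.sq_norm, Complex.normSq_apply]; ring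
  rw [this]
  set x := ∑ n ∈ Finset.range M, (a n).re ^ 2
  set y := ∑ n ∈ Finset.range M, (a n).im ^ 2
  have hx : 0 ≤ x := by positivity
  have hy : 0 ≤ y := by positivity
  -- Subadditivity of the square root, `√(x + y) ≤ √x + √y`.
  refine Real.sqrt_le_iff.2 ⟨by positivity, ?_⟩
  nlinarith [Real.sq_sqrt hx, Real.sq_sqrt hy, mul_nonneg (Real.sqrt_nonneg x) (Real.sqrt_nonneg y)]

end Gaussian


/-! ### A lower bound for `γ`-norms -/

/-- Parseval's identity in the basis `h` for the vector `∑ conj(z k) e k`. It makes the limiting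
square function independent of the choice of `h`. -/
lemma sum_norm_inner_mul_eq {H ι : Type*} [NormedAddCommGroup H] [InnerProductSpace ℂ H]
    {e : ι → H} (he : Orthonormal ℂ e) (h : HilbertBasis ℕ ℂ H) (A : Finset ι) (z : ι → ℂ) :
    HasSum (fun n => ‖∑ k ∈ A, inner ℂ (e k) (h n) * z k‖ ^ 2) (∑ k ∈ A, ‖z k‖ ^ 2) := by
  set v : H := ∑ k ∈ A, (starRingEnd ℂ (z k)) • e k
  have hv : ∀ n, inner ℂ v (h n) = ∑ k ∈ A, inner ℂ (e k) (h n) * z k := fun n => by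
    simp [v, mul_comm]
  have hvv : inner ℂ v v = ((∑ k ∈ A, ‖z k‖ ^ 2 : ℝ) : ℂ) := by
    rw [he.inner_sum]
    push_cast
    refine Finset.sum_congr rfl fun k _ => ?_
    rw [Complex.conj_conj, Complex.mul_conj, Complex.normSq_eq_norm_sq]
    push_cast; rfl
  have hs := h.hasSum_inner_mul_inner v v
  rw [hvv] at hs
  have hvn : (fun n => inner ℂ v (h n) * inner ℂ (h n) v)
      = fun n => ((‖∑ k ∈ A, inner ℂ (e k) (h n) * z k‖ ^ 2 : ℝ) : ℂ) := by
    ext n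
    rw [← inner_conj_symm (h n) v, Complex.mul_conj, Complex.normSq_eq_norm_sq, hv n]
  rw [hvn] at hs
  exact Complex.hasSum_ofReal.1 hs

lemma one_div_toReal_le_one {q : ℝ≥0∞} (hq : 1 ≤ q) : 1 / q.toReal ≤ 1 := by
  rcases eq_or_ne q ∞ with rfl | hq'
  · simp
  · have : 1 ≤ q.toReal := by
      rw [← ENNReal.toReal_one]
      exact ENNReal.toReal_mono hq' hq
    exact (div_le_one (by linarith)).2 this

section LowerBound

variable {d : ℕ} {σ : ℝ} {q : ℝ≥0∞} [Fact (1 ≤ q)]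
  {Ω : Type*} [MeasurableSpace Ω] {P : Measure Ω} [IsProbabilityMeasure P] {γ : ℕ → Ω → ℝ}
  {ι : Type*} {A : Finset ι} {e : ι → LpTorus d 2} {F : ι → C(UnitAddTorus (Fin d), ℂ)}
  {T : LpTorus d 2 →L[ℂ] BesselSpace d σ q}

/-- Hölder's inequality on `B`, between `L¹` and `L^q`, for a fixed realisation `c` of the Gaussian
variables. -/
lemma enorm_apply_sum_ge
    (hT : ∀ f, BesselSpace.toLp (T f) =ᵐ[torusMeasure d] fun x => ∑ k ∈ A, inner ℂ (e k) f * F k x)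
    (h : ℕ → LpTorus d 2) (c : ℕ → ℝ) (M : ℕ) (B : Set (UnitAddTorus (Fin d))) :
    ∫⁻ x in B, ‖∑ n ∈ Finset.range M, (c n : ℂ) * ∑ k ∈ A, inner ℂ (e k) (h n) * F k x‖ₑ
        ∂(torusMeasure d)
      ≤ ‖∑ n ∈ Finset.range M, (c n : ℂ) • T (h n)‖ₑ
        * torusMeasure d B ^ (1 - 1 / q.toReal) := by
  have h1 : ∑ n ∈ Finset.range M, (c n : ℂ) • T (h n)
      = T (∑ n ∈ Finset.range M, (c n : ℂ) • h n) := by simp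
  set G : UnitAddTorus (Fin d) → ℂ :=
    fun x => ∑ n ∈ Finset.range M, (c n : ℂ) * ∑ k ∈ A, inner ℂ (e k) (h n) * F k x
  have hG : Continuous G := by fun_prop
  have h2 : BesselSpace.toLp (T (∑ n ∈ Finset.range M, (c n : ℂ) • h n))
      =ᵐ[torusMeasure d] G := by
    filter_upwards [hT (∑ n ∈ Finset.range M, (c n : ℂ) • h n)] with x hx
    rw [hx]
    simp only [G, inner_sum, inner_smul_right, Finset.sum_mul, Finset.mul_sum]
    rw [Finset.sum_comm]
    simp only [mul_assoc]
  have h3 : ‖T (∑ n ∈ Finset.range M, (c n : ℂ) • h n)‖ₑ = eLpNorm G q (torusMeasure d) := by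
    rw [← eLpNorm_congr_ae h2, ← Lp.enorm_def]
    rfl
  rw [h1, h3]
  have h4 := eLpNorm_le_eLpNorm_mul_rpow_measure_univ (μ := (torusMeasure d).restrict B)
    (p := 1) (q := q) Fact.out hG.aestronglyMeasurable
  rw [eLpNorm_one_eq_lintegral_enorm, Measure.restrict_apply_univ, ENNReal.toReal_one,
    div_one] at h4
  refine h4.trans ?_
  gcongr
  exact Measure.restrict_le_self

/-- The Gaussian moment bound is applied at each point `x`, Tonelli's theorem exchanges `x` and `ω`,
the preceding Hölder bound is used for each `ω`, and `L¹(Ω)` is dominated by `L²(Ω)`. -/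
lemma IsGaussianSequence.lintegral_sqrt_le (hγ : IsGaussianSequence P γ)
    (hT : ∀ f, BesselSpace.toLp (T f) =ᵐ[torusMeasure d] fun x => ∑ k ∈ A, inner ℂ (e k) f * F k x)
    (h : ℕ → LpTorus d 2) (M : ℕ) (B : Set (UnitAddTorus (Fin d))) :
    (∫⁻ x, ‖x‖ₑ ∂(gaussianReal 0 1)) * ∫⁻ x in B, ENNReal.ofReal
        (√(∑ n ∈ Finset.range M, ‖∑ k ∈ A, inner ℂ (e k) (h n) * F k x‖ ^ 2)) ∂(torusMeasure d)
      ≤ 2 * (eLpNorm (fun ω => ∑ n ∈ Finset.range M, (γ n ω : ℂ) • T (h n)) 2 P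
        * torusMeasure d B ^ (1 - 1 / q.toReal)) := by
  have hm : ∀ n, AEMeasurable (fun ω => (γ n ω : ℂ)) P := fun n =>
    Complex.measurable_ofReal.comp_aemeasurable (hγ.hasLaw n).aemeasurable
  calc _ = ∫⁻ x in B, (∫⁻ x, ‖x‖ₑ ∂(gaussianReal 0 1)) * ENNReal.ofReal
        (√(∑ n ∈ Finset.range M, ‖∑ k ∈ A, inner ℂ (e k) (h n) * F k x‖ ^ 2))
          ∂(torusMeasure d) := by
        rw [lintegral_const_mul']
        exact lintegral_enorm_gaussianReal_ne_top
    _ ≤ ∫⁻ x in B, 2 * ∫⁻ ω, ‖∑ n ∈ Finset.range M,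
          (γ n ω : ℂ) * ∑ k ∈ A, inner ℂ (e k) (h n) * F k x‖ₑ ∂P ∂(torusMeasure d) :=
        lintegral_mono fun x => hγ.sqrt_sum_le_lintegral_enorm_sum _ M
    _ = 2 * ∫⁻ ω, ∫⁻ x in B, ‖∑ n ∈ Finset.range M,
          (γ n ω : ℂ) * ∑ k ∈ A, inner ℂ (e k) (h n) * F k x‖ₑ ∂(torusMeasure d) ∂P := by
        rw [lintegral_const_mul' _ _ (by simp), lintegral_lintegral_swap]
        refine AEMeasurable.enorm ?_
        refine Finset.aemeasurable_fun_sum _ fun n _ => ?_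
        refine AEMeasurable.mul ?_ ?_
        · exact (hm n).comp_snd
        · refine Measurable.aemeasurable ?_
          fun_prop
    _ ≤ 2 * ∫⁻ ω, ‖∑ n ∈ Finset.range M, (γ n ω : ℂ) • T (h n)‖ₑ
          * torusMeasure d B ^ (1 - 1 / q.toReal) ∂P := by
        gcongr with ω
        exact enorm_apply_sum_ge hT h (fun n => γ n ω) M B
    _ ≤ _ := by
        have hq1 : 1 / q.toReal ≤ 1 := one_div_toReal_le_one Fact.out
        rw [lintegral_mul_const' _ _
          (ENNReal.rpow_ne_top_of_nonneg (by linarith) (measure_ne_top _ _))]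
        gcongr
        rw [← eLpNorm_one_eq_lintegral_enorm]
        refine eLpNorm_le_eLpNorm_of_exponent_le (by norm_num) ?_
        refine Finset.aestronglyMeasurable_fun_sum _ fun n _ => ?_
        exact (hm n).aestronglyMeasurable.smul_const _

lemma IsGaussianSequence.le_gammaNorm (hγ : IsGaussianSequence P γ)
    (hT : ∀ f, BesselSpace.toLp (T f) =ᵐ[torusMeasure d] fun x => ∑ k ∈ A, inner ℂ (e k) f * F k x)
    (he : Orthonormal ℂ e) (h : HilbertBasis ℕ ℂ (LpTorus d 2))
    {B : Set (UnitAddTorus (Fin d))} (hB : MeasurableSet B) {l : ℝ} (hl0 : 0 ≤ l)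
    (hl : ∀ x ∈ B, ∀ k ∈ A, l ≤ ‖F k x‖) :
    (∫⁻ x, ‖x‖ₑ ∂(gaussianReal 0 1)) * (ENNReal.ofReal (√A.card * l) * torusMeasure d B)
      ≤ 2 * (gammaNorm P γ h T * torusMeasure d B ^ (1 - 1 / q.toReal)) := by
  have hq1 : 1 / q.toReal ≤ 1 := one_div_toReal_le_one Fact.out
  have hK := ENNReal.rpow_ne_top_of_nonneg (by linarith : 0 ≤ 1 - 1 / q.toReal)
    (measure_ne_top (torusMeasure d) B)
  set K := torusMeasure d B ^ (1 - 1 / q.toReal)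
  set m := ∫⁻ x, ‖x‖ₑ ∂(gaussianReal 0 1)
  have key : ∀ S, IsGammaSum P γ h T S →
      m * (ENNReal.ofReal (√A.card * l) * torusMeasure d B) ≤ 2 * (eLpNorm S 2 P * K) := by
    rintro S ⟨hS, hlim⟩
    set f : ℕ → UnitAddTorus (Fin d) → ℝ≥0∞ := fun M x => ENNReal.ofReal
      (√(∑ n ∈ Finset.range M, ‖∑ k ∈ A, inner ℂ (e k) (h n) * F k x‖ ^ 2))
    -- The truncated square functions increase with `M`, so monotone convergence applies.
    have hf : Tendsto (fun M => ∫⁻ x in B, f M x ∂(torusMeasure d)) atTop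
        (𝓝 (∫⁻ x in B, ENNReal.ofReal (√(∑ k ∈ A, ‖F k x‖ ^ 2)) ∂(torusMeasure d))) := by
      refine lintegral_tendsto_of_tendsto_of_monotone (fun M => ?_)
        (Eventually.of_forall fun x M N hMN => ?_) (Eventually.of_forall fun x => ?_)
      · refine (ENNReal.continuous_ofReal.comp ?_).aemeasurable
        fun_prop
      · refine ENNReal.ofReal_le_ofReal (Real.sqrt_le_sqrt ?_)
        exact Finset.sum_le_sum_of_subset_of_nonneg (Finset.range_mono hMN)
          fun _ _ _ => by positivity
      · exact (ENNReal.continuous_ofReal.tendsto _).comp ((Real.continuous_sqrt.tendsto _).comp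
          (sum_norm_inner_mul_eq he h A fun k => F k x).tendsto_sum_nat)
    have hleft : Tendsto (fun M => m * ∫⁻ x in B, f M x ∂(torusMeasure d)) atTop
        (𝓝 (m * ∫⁻ x in B, ENNReal.ofReal (√(∑ k ∈ A, ‖F k x‖ ^ 2)) ∂(torusMeasure d))) :=
      ENNReal.Tendsto.const_mul hf (Or.inr lintegral_enorm_gaussianReal_ne_top)
    have hright : Tendsto (fun M => 2 * ((eLpNorm S 2 P + eLpNorm (fun ω => S ω -
        ∑ n ∈ Finset.range M, (γ n ω : ℂ) • T (h n)) 2 P) * K)) atTop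
        (𝓝 (2 * ((eLpNorm S 2 P + 0) * K))) :=
      ENNReal.Tendsto.const_mul (ENNReal.Tendsto.mul_const (hlim.const_add _) (Or.inr hK))
        (Or.inr (by simp))
    rw [add_zero] at hright
    have hle := le_of_tendsto_of_tendsto' hleft hright fun M => by
      refine (hγ.lintegral_sqrt_le hT h M B).trans ?_
      gcongr
      have hm : ∀ n, AEMeasurable (fun ω => (γ n ω : ℂ)) P := fun n =>
        Complex.measurable_ofReal.comp_aemeasurable (hγ.hasLaw n).aemeasurable
      have hSM : AEStronglyMeasurable
          (fun ω => ∑ n ∈ Finset.range M, (γ n ω : ℂ) • T (h n)) P :=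
        Finset.aestronglyMeasurable_fun_sum _ fun n _ =>
          (hm n).aestronglyMeasurable.smul_const _
      have := eLpNorm_sub_le hS.1 (hS.1.sub hSM) (p := 2) (by norm_num)
      refine le_trans (le_of_eq ?_) this
      congr 1
      ext ω : 1
      simp
    refine le_trans ?_ hle
    gcongr
    rw [← setLIntegral_const]
    refine setLIntegral_mono' hB fun x hx => ENNReal.ofReal_le_ofReal ?_
    refine Real.le_sqrt_of_sq_le ?_
    rw [mul_pow, Real.sq_sqrt (by positivity), ← nsmul_eq_mul]
    exact Finset.card_nsmul_le_sum _ _ _ fun k hk => pow_le_pow_left₀ hl0 (hl x hx k hk) 2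
  rw [gammaNorm, mul_left_comm 2]
  -- `K` is a power of a finite measure, so it can vanish only if `B` is null, and then the left
  -- side vanishes too.
  rcases eq_or_ne (2 * K) 0 with h0 | h0
  · by_cases hK0 : torusMeasure d B = 0
    · simp [hK0]
    · exact absurd h0 (mul_ne_zero two_ne_zero
        (ENNReal.rpow_pos (pos_iff_ne_zero.2 hK0) (measure_ne_top _ _)).ne')
  have h2 : 2 * K ≠ ∞ := ENNReal.mul_ne_top (by simp) hK
  -- With `2 * K` moved to the left, it suffices to bound every candidate `S` in the infimum; if
  -- there is none, the infimum is `∞`.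
  rw [← ENNReal.div_le_iff h0 h2]
  refine le_iInf₂ fun S hS => ?_
  rw [ENNReal.div_le_iff h0 h2]
  refine (key S hS).trans (le_of_eq ?_)
  ring


end LowerBound

/-! ### Trigonometric polynomials -/

section Torus

variable {d : ℕ}

lemma mFourierCoeff_congr_ae {f g : UnitAddTorus (Fin d) → ℂ} (hfg : f =ᵐ[torusMeasure d] g)
    (m : Fin d → ℤ) : mFourierCoeff f m = mFourierCoeff g m := by
  simp only [mFourierCoeff_eq_integral_torusMeasure]
  refine integral_congr_ae ?_
  filter_upwards [hfg] with t ht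
  rw [ht]

lemma mFourierCoeff_mFourier (k m : Fin d → ℤ) :
    mFourierCoeff (mFourier k : UnitAddTorus (Fin d) → ℂ) m = if k = m then 1 else 0 := by
  have h := orthonormal_iff_ite.1 (orthonormal_mFourier (d := Fin d)) m k
  rw [ContinuousMap.inner_toLp] at h
  simp only [← mFourier_neg] at h
  rw [if_congr eq_comm rfl rfl, ← h, mFourierCoeff_eq_integral_torusMeasure]
  refine integral_congr_ae (Eventually.of_forall fun t => mul_comm _ _)

/-- The frequencies `φ i` may coincide, so products of trigonometric sums need not be collected by
frequency. -/
lemma mFourierCoeff_sum {ι : Type*} (I : Finset ι) (c : ι → ℂ) (φ : ι → Fin d → ℤ)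
    (m : Fin d → ℤ) :
    mFourierCoeff (fun x => ∑ i ∈ I, c i * mFourier (φ i) x) m
      = ∑ i ∈ I, if φ i = m then c i else 0 := by
  have hi : ∀ i, Integrable (mFourier (φ i) : UnitAddTorus (Fin d) → ℂ) (torusMeasure d) :=
    fun i => integrable_LpTorus (q := 1) (mFourierLp 1 (φ i)) |>.congr (coeFn_mFourierLp 1 (φ i))
  rw [mFourierCoeff_eq_integral_torusMeasure]
  simp only [Finset.mul_sum, mul_left_comm _ (c _)]
  rw [integral_finsetSum _ fun i _ => (integrable_mFourier_mul (hi i) _).const_mul _]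
  refine Finset.sum_congr rfl fun i _ => ?_
  rw [integral_const_mul, ← mFourierCoeff_eq_integral_torusMeasure, mFourierCoeff_mFourier]
  simp

lemma mFourier_coe (m : Fin d → ℤ) (y : Fin d → ℝ) :
    mFourier m (fun i => (y i : UnitAddCircle))
      = Complex.exp (((2 * Real.pi * ∑ i, (m i : ℝ) * y i : ℝ) : ℂ) * Complex.I) := by
  change ∏ i, fourier (m i) (y i : UnitAddCircle) = _
  simp only [fourier_coe_apply]
  rw [← Complex.exp_sum]
  congr 1
  push_cast
  rw [Finset.mul_sum, Finset.sum_mul]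
  refine Finset.sum_congr rfl fun i _ => ?_
  ring

/-- The frequencies in `{0, …, N - 1}ᵈ`. -/
noncomputable def freqBox (d N : ℕ) : Finset (Fin d → ℤ) := Fintype.piFinset fun _ => Finset.Ico 0 (N : ℤ)

lemma card_freqBox (N : ℕ) : (freqBox d N).card = N ^ d := by
  simp [freqBox]

lemma abs_sub_le_of_mem_freqBox {N : ℕ} {j k : Fin d → ℤ} (hj : j ∈ freqBox d N)
    (hk : k ∈ freqBox d N) (i : Fin d) : |((j - k) i : ℝ)| ≤ N := by
  have h1 := Finset.mem_Ico.1 (Fintype.mem_piFinset.1 hj i)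
  have h2 := Finset.mem_Ico.1 (Fintype.mem_piFinset.1 hk i)
  have h3 : |(j - k) i| ≤ N := by
    rw [Pi.sub_apply, abs_le]; omega
  exact_mod_cast h3

/-- The Fejér kernel (not normalised) `|∑_{j ∈ {0, …, N - 1}ᵈ} e_j|²`. -/
noncomputable def fejer (d N : ℕ) (x : UnitAddTorus (Fin d)) : ℝ := ‖∑ j ∈ freqBox d N, mFourier j x‖ ^ 2

lemma isSmooth_fejer (N : ℕ) : IsSmooth (fejer d N) := by
  unfold IsSmooth fejer
  refine ContDiff.norm_sq ℂ ?_
  simp only [mFourier_coe]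
  refine ContDiff.sum fun j _ => ContDiff.cexp ?_
  refine ContDiff.mul ?_ contDiff_const
  exact Complex.ofRealCLM.contDiff.comp
    (contDiff_const.mul (ContDiff.sum fun i _ => contDiff_const.mul (contDiff_apply ℝ ℝ i)))

lemma continuous_fejer (N : ℕ) : Continuous (fejer d N) := by
  unfold fejer
  fun_prop

lemma fejer_nonneg (N : ℕ) (x : UnitAddTorus (Fin d)) : 0 ≤ fejer d N x := sq_nonneg _

lemma norm_mFourier_apply (k : Fin d → ℤ) (x : UnitAddTorus (Fin d)) : ‖mFourier k x‖ = 1 := by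
  change ‖∏ i, fourier (k i) (x i)‖ = 1
  rw [norm_prod]
  exact Finset.prod_eq_one fun i _ => Circle.norm_coe _

lemma fejer_le (N : ℕ) (x : UnitAddTorus (Fin d)) : fejer d N x ≤ (N : ℝ) ^ (2 * d) := by
  have h : ‖∑ j ∈ freqBox d N, mFourier j x‖ ≤ (N : ℝ) ^ d := by
    refine (norm_sum_le _ _).trans ?_
    simp [norm_mFourier_apply, card_freqBox]
  rw [fejer, mul_comm, pow_mul]
  exact pow_le_pow_left₀ (norm_nonneg _) h 2

lemma ofReal_fejer (N : ℕ) (x : UnitAddTorus (Fin d)) :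
    (fejer d N x : ℂ) = ∑ p ∈ freqBox d N ×ˢ freqBox d N, mFourier (p.1 - p.2) x := by
  rw [fejer, ← Complex.normSq_eq_norm_sq, ← Complex.mul_conj, map_sum, Finset.sum_mul_sum,
    Finset.sum_product]
  simp only [sub_eq_add_neg, mFourier_add, mFourier_neg]

/-- By nonnegativity this is the zeroth Fourier coefficient, which counts the pairs with `p.1 =
p.2`. -/
lemma lintegral_enorm_fejer (N : ℕ) :
    ∫⁻ x, ‖fejer d N x‖ₑ ∂(torusMeasure d) = ENNReal.ofReal ((N : ℝ) ^ d) := by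
  have h1 : Integrable (fejer d N) (torusMeasure d) :=
    (continuous_fejer N).integrable_of_hasCompactSupport (HasCompactSupport.of_compactSpace _)
  have h2 : ((∫ x, fejer d N x ∂(torusMeasure d) : ℝ) : ℂ) = (N : ℂ) ^ d := by
    rw [← integral_complex_ofReal]
    have h3 := mFourierCoeff_sum (d := d) (freqBox d N ×ˢ freqBox d N) (fun _ => 1)
      (fun p => p.1 - p.2) 0
    simp only [one_mul, ← ofReal_fejer] at h3
    rw [mFourierCoeff_eq_integral_torusMeasure] at h3
    simp only [neg_zero, mFourier_zero, ContinuousMap.one_apply, one_mul, sub_eq_zero] at h3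
    rw [h3, Finset.sum_product]
    simp [card_freqBox]
  have h4 : ∫ x, fejer d N x ∂(torusMeasure d) = (N : ℝ) ^ d := by exact_mod_cast h2
  rw [← h4, ofReal_integral_eq_lintegral_ofReal h1 (Eventually.of_forall (fejer_nonneg N))]
  refine lintegral_congr fun x => ?_
  rw [Real.enorm_eq_ofReal (fejer_nonneg N x)]

/-- Interpolation: `g^η ≤ ‖g‖_∞^{η-1} g`, integrated. -/
lemma eLpNorm_fejer_le {N : ℕ} (hN : 0 < N) {η : ℝ≥0∞} (hη : 1 < η) (hη' : η < ∞) :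
    eLpNorm (fejer d N) η (torusMeasure d)
      ≤ ENNReal.ofReal ((N : ℝ) ^ (2 * d - d * (η⁻¹).toReal : ℝ)) := by
  have hN' : (0 : ℝ) < N := by exact_mod_cast hN
  have hη1 : 1 < η.toReal := by
    rw [← ENNReal.toReal_one]; exact (ENNReal.toReal_lt_toReal (by simp) hη'.ne).2 hη
  rw [eLpNorm_eq_lintegral_rpow_enorm_toReal (by positivity) hη'.ne]
  have h1 : ∫⁻ x, ‖fejer d N x‖ₑ ^ η.toReal ∂(torusMeasure d)
      ≤ ENNReal.ofReal ((N : ℝ) ^ d * ((N : ℝ) ^ (2 * d)) ^ (η.toReal - 1)) := by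
    rw [ENNReal.ofReal_mul (by positivity), ← lintegral_enorm_fejer, ← lintegral_mul_const' _ _
      (by simp)]
    refine lintegral_mono fun x => ?_
    rw [Real.enorm_eq_ofReal (fejer_nonneg N x),
      ENNReal.ofReal_rpow_of_nonneg (fejer_nonneg N x) (by linarith),
      ← ENNReal.ofReal_mul (fejer_nonneg N x)]
    refine ENNReal.ofReal_le_ofReal ?_
    have : fejer d N x ^ η.toReal = fejer d N x * fejer d N x ^ (η.toReal - 1) := by
      rw [← Real.rpow_one_add' (fejer_nonneg N x) (by linarith)]
      congr 1; ring
    rw [this]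
    exact mul_le_mul_of_nonneg_left (Real.rpow_le_rpow (fejer_nonneg N x) (fejer_le N x)
      (by linarith)) (fejer_nonneg N x)
  refine (ENNReal.rpow_le_rpow h1 (by positivity)).trans (le_of_eq ?_)
  rw [ENNReal.ofReal_rpow_of_pos (by positivity)]
  congr 1
  rw [← Real.rpow_natCast, ← Real.rpow_natCast, ← Real.rpow_mul hN'.le, ← Real.rpow_add hN',
    ← Real.rpow_mul hN'.le, ENNReal.toReal_inv]
  congr 1
  push_cast
  field_simp
  ring

/-! ### The sequence `μ` and the functions `(1 - Δ)^{σ/2} (g e_k)` -/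

/-- The indicator of `{0, …, N - 1}ᵈ`. -/
noncomputable def boxIndicator (d N : ℕ) : (Fin d → ℤ) →₀ ℝ :=
  Finsupp.onFinset (freqBox d N) (fun k => if k ∈ freqBox d N then 1 else 0) (by simp)

lemma support_boxIndicator (N : ℕ) : (boxIndicator d N).support = freqBox d N := by
  ext k; simp [boxIndicator]

lemma eLpNorm_boxIndicator_le {N : ℕ} (hN : 0 < N) (ζ : ℝ≥0∞) :
    eLpNorm (boxIndicator d N) ζ Measure.count
      ≤ ENNReal.ofReal ((N : ℝ) ^ (d * (ζ⁻¹).toReal : ℝ)) := by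
  have hN' : (0 : ℝ) < N := by exact_mod_cast hN
  have h : (boxIndicator d N : (Fin d → ℤ) → ℝ)
      = (freqBox d N : Set (Fin d → ℤ)).indicator fun _ => (1 : ℝ) := by
    ext k; simp [boxIndicator, Set.indicator_apply]
  rw [h]
  refine (eLpNorm_indicator_const_le _ _).trans (le_of_eq ?_)
  rw [Measure.count_apply_finset, card_freqBox, enorm_one, one_mul, one_div, ENNReal.toReal_inv,
    Real.rpow_mul hN'.le, ← ENNReal.ofReal_rpow_of_pos (by positivity), Real.rpow_natCast,
    ENNReal.ofReal_pow hN'.le]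
  simp

lemma diagonalOp_boxIndicator (N : ℕ) (f : LpTorus d 2) :
    diagonalOp (boxIndicator d N) f
      =ᵐ[torusMeasure d] fun x => ∑ k ∈ freqBox d N,
        inner ℂ (mFourierLp 2 k : LpTorus d 2) f * mFourier k x := by
  have h : diagonalOp (boxIndicator d N) f = ContinuousMap.toLp 2 (torusMeasure d) ℂ
      (∑ k ∈ freqBox d N, inner ℂ (mFourierLp 2 k : LpTorus d 2) f • mFourier k) := by
    rw [diagonalOp, support_boxIndicator, map_sum, sum_apply]
    refine Finset.sum_congr rfl fun k hk => ?_
    have : boxIndicator d N k = 1 := by simp [boxIndicator, hk]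
    rw [this, map_smul, smul_apply, InnerProductSpace.rankOne_apply, Complex.ofReal_one, one_smul]
    rfl
  rw [h]
  filter_upwards [ContinuousMap.coeFn_toLp (p := 2) (𝕜 := ℂ) (torusMeasure d)
    (∑ k ∈ freqBox d N, inner ℂ (mFourierLp 2 k : LpTorus d 2) f • mFourier k)] with x hx
  rw [hx]
  simp

/-- The function `(1 - Δ)^{σ/2} (g e_k)`, where `g` is the Fejér kernel. -/
noncomputable def besselFejer (d N : ℕ) (σ : ℝ) (k : Fin d → ℤ) : C(UnitAddTorus (Fin d), ℂ) :=
  ∑ p ∈ freqBox d N ×ˢ freqBox d N,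
    ((symbol (p.1 - p.2 + k) ^ (σ / 2) : ℝ) : ℂ) • mFourier (p.1 - p.2 + k)

/-- The right side is a trigonometric polynomial, so it suffices to match Fourier coefficients,
which determine an `L^q` function. -/
lemma toLp_apply_ae_eq {σ : ℝ} {q : ℝ≥0∞} [Fact (1 ≤ q)] {N : ℕ}
    {T : LpTorus d 2 →L[ℂ] BesselSpace d σ q}
    (hT : IsMulComp (fejer d N) (diagonalOp (boxIndicator d N)) T) (f : LpTorus d 2) :
    BesselSpace.toLp (T f) =ᵐ[torusMeasure d] fun x => ∑ k ∈ freqBox d N,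
      inner ℂ (mFourierLp 2 k : LpTorus d 2) f * besselFejer d N σ k x := by
  set c : (Fin d → ℤ) → ℂ := fun k => inner ℂ (mFourierLp 2 k : LpTorus d 2) f
  set I := freqBox d N ×ˢ (freqBox d N ×ˢ freqBox d N)
  -- Frequency of the product of `e_k` with the term `e_{j-l}` of the kernel, for the triple `(k,
  -- (j, l))`.
  let φ : (Fin d → ℤ) × ((Fin d → ℤ) × (Fin d → ℤ)) → Fin d → ℤ := fun t => t.2.1 - t.2.2 + t.1
  have hcoeff : ∀ m, (T f).1.coeff m = ∑ t ∈ I, if φ t = m then c t.1 else 0 := by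
    intro m
    rw [hT f m, ← mFourierCoeff_sum I (fun t => c t.1) φ]
    refine mFourierCoeff_congr_ae (d := d) ?_ m
    filter_upwards [diagonalOp_boxIndicator N f] with x hx
    rw [hx, Finset.mul_sum, Finset.sum_product]
    refine Finset.sum_congr rfl fun k _ => ?_
    rw [ofReal_fejer, Finset.sum_mul]
    refine Finset.sum_congr rfl fun p _ => ?_
    simp only [φ, mFourier_add (m := p.1 - p.2)]
    ring
  set G : C(UnitAddTorus (Fin d), ℂ) := ∑ k ∈ freqBox d N, c k • besselFejer d N σ k
  have hG : ∀ x, G x = ∑ k ∈ freqBox d N, c k * besselFejer d N σ k x := fun x => by simp [G]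
  have hG' : ∀ x, G x = ∑ t ∈ I,
      (((symbol (φ t) ^ (σ / 2) : ℝ) : ℂ) * c t.1) * mFourier (φ t) x := fun x => by
    rw [hG, Finset.sum_product]
    refine Finset.sum_congr rfl fun k _ => ?_
    simp only [besselFejer, ContinuousMap.coe_sum, Finset.sum_apply, ContinuousMap.smul_apply,
      smul_eq_mul, Finset.mul_sum, φ]
    refine Finset.sum_congr rfl fun p _ => ?_
    ring
  have hGae := ContinuousMap.coeFn_toLp (p := q) (𝕜 := ℂ) (torusMeasure d) G
  have key : BesselSpace.toLp (T f) = ContinuousMap.toLp q (torusMeasure d) ℂ G := by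
    apply LpTorus.toDistribution_injective q
    rw [BesselSpace.toDistribution_toLp]
    refine PeriodicDistribution.ext fun m => ?_
    change ((symbol m ^ (σ / 2) : ℝ) : ℂ) * (T f).1.coeff m
      = mFourierCoeff (ContinuousMap.toLp q (torusMeasure d) ℂ G) m
    rw [mFourierCoeff_congr_ae hGae, funext hG', mFourierCoeff_sum, hcoeff, Finset.mul_sum]
    refine Finset.sum_congr rfl fun t _ => ?_
    by_cases h : φ t = m
    · simp [h]
    · simp [h]
  rw [key]
  filter_upwards [hGae] with x hx
  rw [hx, hG]

/-! ### Lower bounds near the origin -/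

/-- A cube around the origin of side length comparable to `1 / N`. -/
def cube (d N : ℕ) : Set (UnitAddTorus (Fin d)) :=
  Set.univ.pi fun _ => Metric.closedBall 0 (1 / (2 * Real.pi * d * N))

lemma measurableSet_cube (N : ℕ) : MeasurableSet (cube d N) :=
  MeasurableSet.univ_pi fun _ => Metric.isClosed_closedBall.measurableSet

lemma torusMeasure_cube (hd : 0 < d) {N : ℕ} (hN : 0 < N) :
    torusMeasure d (cube d N) = ENNReal.ofReal ((1 / (Real.pi * d * N)) ^ d) := by
  have hd' : (1 : ℝ) ≤ d := by exact_mod_cast hd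
  have hN' : (1 : ℝ) ≤ N := by exact_mod_cast hN
  rw [cube, Measure.pi_pi]
  have h : ∀ r : ℝ, AddCircle.haarAddCircle (Metric.closedBall (0 : UnitAddCircle) r)
      = ENNReal.ofReal (min 1 (2 * r)) := by
    intro r
    rw [← AddCircle.volume_closedBall 1 (x := (0 : UnitAddCircle)), AddCircle.volume_eq_smul_haarAddCircle]
    simp
  have h2 : 2 * (1 / (2 * Real.pi * d * N)) = 1 / (Real.pi * d * N) := by field_simp
  have h3 : 1 / (Real.pi * d * N) ≤ 1 := by
    rw [div_le_one (by positivity)]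
    have := Real.pi_gt_three
    nlinarith [mul_le_mul hd' hN' zero_le_one (by linarith)]
  simp only [h, h2, min_eq_right h3, Finset.prod_const, Finset.card_univ, Fintype.card_fin]
  rw [ENNReal.ofReal_pow (by positivity)]

/-- The radius of the cube is chosen so that the phase `2π m·y` is at most `2π · d · N · 1/(2πdN) =
1` in modulus; then `cos θ ≥ 1 - θ²/2 ≥ 1/2`. -/
lemma re_mFourier_ge (hd : 0 < d) {N : ℕ} (hN : 0 < N) {m : Fin d → ℤ}
    (hm : ∀ i, |(m i : ℝ)| ≤ N) {x : UnitAddTorus (Fin d)} (hx : x ∈ cube d N) :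
    1 / 2 ≤ (mFourier m x).re := by
  have hd' : (0 : ℝ) < d := by exact_mod_cast hd
  have hN' : (0 : ℝ) < N := by exact_mod_cast hN
  have hlift : ∀ i, ∃ y : ℝ, (y : UnitAddCircle) = x i ∧ |y| ≤ 1 / (2 * Real.pi * d * N) := by
    intro i
    obtain ⟨z, hz⟩ := QuotientAddGroup.mk_surjective (x i)
    have hxi : ‖x i‖ ≤ 1 / (2 * Real.pi * d * N) := by
      simpa using hx i (Set.mem_univ i)
    rw [← hz] at hxi ⊢
    -- The representative nearest to `0` has absolute value equal to the norm on the circle.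
    refine ⟨z - round z, ?_, ?_⟩
    · rw [AddCircle.coe_sub, (AddCircle.coe_eq_zero_iff (1 : ℝ) (x := round z)).2 ⟨round z, by simp⟩,
        sub_zero]
    · rwa [← UnitAddCircle.norm_eq]
  choose y hy hy' using hlift
  have hxy : x = fun i => (y i : UnitAddCircle) := funext fun i => (hy i).symm
  rw [hxy, mFourier_coe, Complex.exp_ofReal_mul_I_re]
  set θ := 2 * Real.pi * ∑ i, (m i : ℝ) * y i
  have hθ : |θ| ≤ 1 := by
    have h1 : |∑ i, (m i : ℝ) * y i| ≤ d * (N * (1 / (2 * Real.pi * d * N))) := by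
      refine (Finset.abs_sum_le_sum_abs _ _).trans ?_
      refine (Finset.sum_le_card_nsmul _ _ (N * (1 / (2 * Real.pi * d * N))) fun i _ => ?_).trans
        (by simp)
      rw [abs_mul]
      exact mul_le_mul (hm i) (hy' i) (abs_nonneg _) hN'.le
    rw [abs_mul, abs_of_pos (by positivity : 0 < 2 * Real.pi)]
    refine (mul_le_mul_of_nonneg_left h1 (by positivity)).trans (le_of_eq ?_)
    field_simp
  have h2 := Real.one_sub_sq_div_two_le_cos (x := θ)
  have h3 : θ ^ 2 ≤ 1 := by rw [← sq_abs]; exact pow_le_one₀ (abs_nonneg _) hθ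
  linarith

lemma symbol_le {N : ℕ} (hN : 0 < N) {j l k : Fin d → ℤ} (hj : j ∈ freqBox d N)
    (hl : l ∈ freqBox d N) (hk : k ∈ freqBox d N) :
    symbol (j - l + k) ≤ (1 + 16 * Real.pi ^ 2 * d) * (N : ℝ) ^ 2 := by
  have hN' : (1 : ℝ) ≤ N := by exact_mod_cast hN
  -- Each coordinate of `j - l` is at most `N` in modulus and that of `k` lies in `[0, N]`, so the
  -- sum is at most `2N` in modulus.
  have h : ∀ i, (((j - l + k) i : ℤ) : ℝ) ^ 2 ≤ 4 * (N : ℝ) ^ 2 := by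
    intro i
    have h1 := abs_le.1 (abs_sub_le_of_mem_freqBox hj hl i)
    have h2 := Finset.mem_Ico.1 (Fintype.mem_piFinset.1 hk i)
    have h3 : (0 : ℝ) ≤ k i := by exact_mod_cast h2.1
    have h4 : (k i : ℝ) ≤ N := by exact_mod_cast h2.2.le
    rw [Pi.add_apply, Int.cast_add]
    nlinarith
  have hs : ∑ i, (((j - l + k) i : ℤ) : ℝ) ^ 2 ≤ d * (4 * (N : ℝ) ^ 2) := by
    refine (Finset.sum_le_card_nsmul _ _ _ fun i _ => h i).trans (by simp)
  unfold symbol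
  have hp : 0 ≤ 4 * Real.pi ^ 2 := by positivity
  nlinarith [mul_le_mul_of_nonneg_left hs hp]

/-- Factoring out the unimodular `e_k` leaves only the frequencies `p.1 - p.2`, whose real parts are
at least `1/2` on the cube. The weights are positive, so nothing cancels, and the upper bound on the
symbol bounds them from below because the exponent is negative. -/
lemma norm_besselFejer_ge (hd : 0 < d) {N : ℕ} (hN : 0 < N) {s : ℝ} (hs : 0 < s)
    {k : Fin d → ℤ} (hk : k ∈ freqBox d N) {x : UnitAddTorus (Fin d)} (hx : x ∈ cube d N) :
    (N : ℝ) ^ (2 * d) * (((1 + 16 * Real.pi ^ 2 * d) * (N : ℝ) ^ 2) ^ (-s / 2) * (1 / 2))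
      ≤ ‖besselFejer d N (-s) k x‖ := by
  have h1 : besselFejer d N (-s) k x = (∑ p ∈ freqBox d N ×ˢ freqBox d N,
      ((symbol (p.1 - p.2 + k) ^ (-s / 2) : ℝ) : ℂ) * mFourier (p.1 - p.2) x)
        * mFourier k x := by
    rw [Finset.sum_mul]
    simp [besselFejer, mFourier_add (n := k), mul_assoc]
  rw [h1, norm_mul, norm_mFourier_apply, mul_one]
  refine le_trans ?_ (Complex.re_le_norm _)
  rw [Complex.re_sum]
  have hcard : ((freqBox d N ×ˢ freqBox d N).card : ℝ) = (N : ℝ) ^ (2 * d) := by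
    rw [Finset.card_product, card_freqBox]; push_cast; ring
  rw [← hcard, ← nsmul_eq_mul]
  refine Finset.card_nsmul_le_sum _ _ _ fun p hp => ?_
  obtain ⟨hp1, hp2⟩ := Finset.mem_product.1 hp
  rw [Complex.re_ofReal_mul]
  refine mul_le_mul ?_ (re_mFourier_ge hd hN (abs_sub_le_of_mem_freqBox hp1 hp2) hx)
    (by norm_num) (Real.rpow_nonneg (symbol_pos _).le _)
  exact Real.rpow_le_rpow_of_nonpos (symbol_pos _) (symbol_le hN hp1 hp2 hk) (by linarith)

end Torus

/-! ### Comparison of powers of `N` and conclusion -/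

lemma exponent_le_of_forall_mul_rpow_le {a b K L : ℝ} (hK : 0 < K)
    (h : ∀ N : ℕ, 0 < N → K * (N : ℝ) ^ a ≤ L * (N : ℝ) ^ b) : a ≤ b := by
  by_contra! hab
  have ht := (tendsto_rpow_atTop (sub_pos.2 hab)).comp tendsto_natCast_atTop_atTop
  obtain ⟨N, hN, hN0⟩ := ((ht.eventually_gt_atTop (L / K)).and (eventually_gt_atTop 0)).exists
  have hN' : (0 : ℝ) < N := by exact_mod_cast hN0
  have h1 := h N hN0
  have h2 : (N : ℝ) ^ a = (N : ℝ) ^ (a - b) * (N : ℝ) ^ b := by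
    rw [← Real.rpow_add hN']; congr 1; ring
  rw [h2, ← mul_assoc] at h1
  have h3 := le_of_mul_le_mul_right h1 (Real.rpow_pos_of_pos hN' b)
  have h4 : L / K < (N : ℝ) ^ (a - b) := hN
  rw [div_lt_iff₀ hK] at h4
  linarith

end PeriodicSobolev

open PeriodicSobolev
theorem propositionp (d : ℕ) (q η ζ : ℝ≥0∞) [Fact (1 ≤ q)] (s : ℝ)
    (hq : 1 < q) (hq' : q < ∞) (hη : 1 < η) (hη' : η < ∞) (hζ : 2 ≤ ζ)
    (hs : 0 < s) (hs' : s < d)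
    {Ω : Type*} [MeasurableSpace Ω] (P : Measure Ω) [IsProbabilityMeasure P]
    (γ : ℕ → Ω → ℝ) (hγ : IsGaussianSequence P γ)
    (h : HilbertBasis ℕ ℂ (LpTorus d 2))
    (hbound : ∃ C : ℝ, 0 < C ∧
      ∀ g : UnitAddTorus (Fin d) → ℝ, IsSmooth g → ∀ μ : (Fin d → ℤ) →₀ ℝ,
        ∃ T : LpTorus d 2 →L[ℂ] BesselSpace d (-s) q, IsMulComp g (diagonalOp μ) T ∧
          gammaNorm P γ h T ≤
            ENNReal.ofReal C * eLpNorm μ ζ Measure.count * eLpNorm g η (torusMeasure d)) :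
    s / d + (q⁻¹).toReal ≥ (η⁻¹).toReal + 1 / 2 - (ζ⁻¹).toReal := by
  obtain ⟨C, hC, hbound⟩ := hbound
  have hd' : (0 : ℝ) < d := hs.trans hs'
  have hd : 0 < d := by exact_mod_cast hd'
  set m : ℝ := (∫⁻ x, ‖x‖ₑ ∂(gaussianReal 0 1)).toReal
  have hm : ENNReal.ofReal m = ∫⁻ x, ‖x‖ₑ ∂(gaussianReal 0 1) :=
    ENNReal.ofReal_toReal lintegral_enorm_gaussianReal_ne_top
  have hm0 : 0 < m := ENNReal.toReal_pos lintegral_enorm_gaussianReal_ne_zero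
    lintegral_enorm_gaussianReal_ne_top
  set D : ℝ := 1 + 16 * Real.pi ^ 2 * d
  have hD : 0 < D := by positivity
  set κ : ℝ := 1 / (Real.pi * d)
  have hκ : 0 < κ := by positivity
  have hr : 0 ≤ 1 - 1 / q.toReal := sub_nonneg.2 (one_div_toReal_le_one hq.le)
  -- On the left: `d/2` from the square root of the number of frequencies, `2d - s` from the
  -- pointwise bound, `-d` from the measure of the cube. On the right: the norms of `μ` and `g`, and
  -- the Hölder factor.
  have main : (d / 2 + 2 * d - s - d : ℝ) ≤ d * (ζ⁻¹).toReal + (2 * d - d * (η⁻¹).toReal)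
      - d * (1 - 1 / q.toReal) := by
    refine exponent_le_of_forall_mul_rpow_le (K := m * (D ^ (-s / 2) * (1 / 2) * κ ^ d))
      (L := 2 * C * (κ ^ d) ^ (1 - 1 / q.toReal)) (by positivity) fun N hN => ?_
    have hN' : (0 : ℝ) < N := by exact_mod_cast hN
    obtain ⟨T, hT, hle⟩ := hbound (fejer d N) (isSmooth_fejer N) (boxIndicator d N)
    have h1 := hγ.le_gammaNorm (toLp_apply_ae_eq hT) orthonormal_mFourier h (measurableSet_cube N)
      (by positivity) fun x hx k hk => norm_besselFejer_ge hd hN hs hk hx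
    have h2 : gammaNorm P γ h T ≤ ENNReal.ofReal (C * (N : ℝ) ^ (d * (ζ⁻¹).toReal : ℝ)
        * (N : ℝ) ^ (2 * d - d * (η⁻¹).toReal : ℝ)) := by
      rw [ENNReal.ofReal_mul (by positivity), ENNReal.ofReal_mul hC.le]
      exact hle.trans (mul_le_mul' (mul_le_mul_right (eLpNorm_boxIndicator_le hN ζ) _)
        (eLpNorm_fejer_le hN hη hη'))
    have h3 := h1.trans (mul_le_mul_right (mul_le_mul_left h2 _) 2)
    have hpos : 0 < (1 / (Real.pi * d * N)) ^ d := by positivity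
    rw [torusMeasure_cube hd hN, ← hm, ← ENNReal.ofReal_mul (by positivity),
      ← ENNReal.ofReal_mul hm0.le, ENNReal.ofReal_rpow_of_pos hpos,
      ← ENNReal.ofReal_mul (by positivity), ← ENNReal.ofReal_ofNat 2,
      ← ENNReal.ofReal_mul (by norm_num), ENNReal.ofReal_le_ofReal_iff (by positivity),
      card_freqBox] at h3
    have hcube : (1 / (Real.pi * d * N)) ^ d = κ ^ d * (N : ℝ) ^ (-d : ℝ) := by
      rw [Real.rpow_neg hN'.le, Real.rpow_natCast, ← inv_pow, ← mul_pow]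
      congr 1
      simp only [κ]
      field_simp
    have hsqrt : √((N ^ d : ℕ) : ℝ) = (N : ℝ) ^ (d / 2 : ℝ) := by
      rw [Real.sqrt_eq_rpow, Nat.cast_pow, ← Real.rpow_natCast, ← Real.rpow_mul hN'.le]
      congr 1; ring
    have hsym : (D * (N : ℝ) ^ 2) ^ (-s / 2) = D ^ (-s / 2) * (N : ℝ) ^ (-s) := by
      rw [Real.mul_rpow hD.le (by positivity), ← Real.rpow_natCast, ← Real.rpow_mul hN'.le]
      congr 2; push_cast; ring
    have hpow : (N : ℝ) ^ (2 * d) = (N : ℝ) ^ (2 * d : ℝ) := by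
      rw [← Real.rpow_natCast]; push_cast; rfl
    rw [hcube, hsqrt, hsym, hpow, Real.mul_rpow (by positivity) (by positivity),
      ← Real.rpow_mul hN'.le] at h3
    have e1 : (d / 2 + 2 * d - s - d : ℝ) = d / 2 + 2 * d + -s + -d := by ring
    have e2 : d * (ζ⁻¹).toReal + (2 * d - d * (η⁻¹).toReal) - d * (1 - 1 / q.toReal)
      = d * (ζ⁻¹).toReal + (2 * d - d * (η⁻¹).toReal) + -d * (1 - 1 / q.toReal) := by ring
    rw [e1, e2]
    simp only [Real.rpow_add hN']
    refine (le_of_eq ?_).trans (h3.trans (le_of_eq ?_)) <;> ring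
  rw [ENNReal.toReal_inv q, ← one_div]
  -- Writing `s` as a multiple of `d` lets the common factor `d` be cancelled by a linear argument.
  have hsd : s = d * (s / d) := by field_simp
  rw [hsd] at main
  refine le_of_mul_le_mul_left ?_ hd'
  linarith
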